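/- Let $A$ be a real $n\times n$ matrix. For a complex eigenvalue $\lambda=a+\iota b$ of $A$ (with $a,b$ real) let $\mathrm{algm}(\lambda)$ be its algebraic multiplicity (its multiplicity as a root of the characteristic polynomial) and $\mathrm{geom}(\lambda)$ its geometric multiplicity (the dimension of the kernel of $A-\lambda I$ over $\mathbb{C}$). Define (a) $\mathrm{num}(\lambda)=\mathrm{algm}(\lambda)$ if $\lambda$ is real and $\lambda<0$; (b) $\mathrm{num}(\lambda)=\mathrm{geom}(\lambda)$ if $\lambda=0$; (c) $\mathrm{num}(\lambda)=\mathrm{algm}(\lambda)$ if $\lambda$ is not real and $a+|b|<0$; (d) $\mathrm{num}(\lambda)=\mathrm{geom}(\lambda)$ if $\lambda$ is not real and $a+|b|=0$; (e) $\mathrm{num}(\lambda)=0$ otherwise. Let $s=\sum_\lambda \mathrm{num}(\lambda)$, the sum being over the distinct complex eigenvalues of $A$ (so $\lambda$ and $\bar\lambda$ are counted separately if $\lambda$ is not real). Then the linear system $dx/dt=Ax$ has a $2s$-linear invariant given by linearly independent functionals: there is a real $s\times n$ matrix $F$ with linearly independent rows such that the polyhedron $\{x\in\mathbb{R}^n :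 \|Fx\|_\infty\le 1\}$, a conjunction of $2s$ linear inequalities, is positively invariant, i.e. every solution $x(t)$ of $dx/dt=Ax$ on $[0,\infty)$ with $\|Fx(0)\|_\infty\le 1$ satisfies $\|Fx(t)\|_\infty\le 1$ for all $t\ge 0$. -/

import Mathlib

/-- `x` is a trajectory on `[0, ∞)` of the linear system `dx/dt = A x`
(at `t = 0` the derivative is the right derivative). -/
def IsTrajectory {n : ℕ} (A : Matrix (Fin n) (Fin n) ℝ) (x : ℝ → Fin n → ℝ) : Prop :=
  ∀ t : ℝ, 0 ≤ t → HasDerivWithinAt x (A.mulVec (x t)) (Set.Ici 0) t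

/-- A set of states is (positively) invariant for `dx/dt = A x` if every trajectory that
starts in it stays in it for all `t ≥ 0`. -/
def IsInvariantSet {n : ℕ} (A : Matrix (Fin n) (Fin n) ℝ) (S : Set (Fin n → ℝ)) : Prop :=
  ∀ x : ℝ → Fin n → ℝ, IsTrajectory A x → x 0 ∈ S → ∀ t : ℝ, 0 ≤ t → x t ∈ S

/-- The `s × n` matrix `F` defines a `2s`-linear invariant of `dx/dt = A x`: the polyhedron
`‖F x‖_∞ ≤ 1` is an invariant set. The norm on `Fin s → ℝ` is the maximum norm. -/
def IsLinearInvariant {n s : ℕ} (A : Matrix (Fin n) (Fin n) ℝ)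
    (F : Matrix (Fin s) (Fin n) ℝ) : Prop :=
  IsInvariantSet A {x | ‖F.mulVec x‖ ≤ 1}

/-- The real matrix `A`, regarded as a complex matrix. -/
noncomputable def complexify {n : ℕ} (A : Matrix (Fin n) (Fin n) ℝ) :
    Matrix (Fin n) (Fin n) ℂ :=
  A.map (algebraMap ℝ ℂ)

/-- The finite set of distinct (complex) eigenvalues of `A`. -/
noncomputable def eigenvalueSet {n : ℕ} (A : Matrix (Fin n) (Fin n) ℝ) : Finset ℂ :=
  (complexify A).charpoly.roots.toFinset

/-- Algebraic multiplicity: multiplicity as a root of the characteristic polynomial. -/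
noncomputable def algm {n : ℕ} (A : Matrix (Fin n) (Fin n) ℝ) (l : ℂ) : ℕ :=
  (complexify A).charpoly.rootMultiplicity l

/-- Geometric multiplicity: the complex dimension of the kernel of `A - l I`. -/
noncomputable def geom {n : ℕ} (A : Matrix (Fin n) (Fin n) ℝ) (l : ℂ) : ℕ :=
  Module.finrank ℂ (LinearMap.ker (Matrix.toLin' (complexify A - l • (1 : Matrix _ _ ℂ))))

open Classical in
/-- The contribution of the eigenvalue `l = a + i b`: the first two cases are those of a real
eigenvalue, the next two those of a nonreal one. -/
noncomputable def num {n : ℕ} (A : Matrix (Fin n) (Fin n) ℝ) (l : ℂ) : ℕ :=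
  if l.im = 0 ∧ l.re < 0 then algm A l
  else if l.im = 0 ∧ l.re = 0 then geom A l
  else if l.im ≠ 0 ∧ l.re + |l.im| < 0 then algm A l
  else if l.im ≠ 0 ∧ l.re + |l.im| = 0 then geom A l
  else 0

/-! If `‖F A x + c F x‖ ≤ c ‖F x‖` for all `x`, then Grönwall applied to `exp (c t) • F x(t)` shows
that `‖F x(t)‖` never exceeds its initial value. It remains to find enough independent rows
satisfying this bound.

For a left eigenvector `v` with eigenvalue `a + ib`, the real and imaginary parts of `z = v ⬝ᵥ x`
satisfy `p' = a p - b q` and `q' = a q + b p`, so in the maximum norm they do not grow when `a + |b|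
≤ 0`. When `a + |b| < 0` there is slack: a basis of the whole generalized eigenspace can be scaled
so that its nilpotent part is absorbed, and the algebraic multiplicity counts. When `a + |b| = 0`
there is none, so true eigenvectors are used and the geometric multiplicity counts.

Generalized eigenspaces for distinct eigenvalues are independent. Choosing the families for `l` and
its conjugate to be conjugate, the real parts from one and the imaginary parts from the other give
one real row per complex vector. -/

open Matrix

/-! ### Grönwall criterion for invariance. -/

/-- If `‖F A x + c F x‖ ≤ c ‖F x‖` for all states `x`, then `‖F x‖ ≤ 1` is an invariant. -/
theorem isLinearInvariant_of_norm_le {n s : ℕ} {A : Matrix (Fin n) (Fin n) ℝ}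
    {F : Matrix (Fin s) (Fin n) ℝ} {c : ℝ}
    (h : ∀ x, ‖F *ᵥ (A *ᵥ x) + c • (F *ᵥ x)‖ ≤ c * ‖F *ᵥ x‖) : IsLinearInvariant A F := by
  intro x hx h0 t ht
  let L : (Fin n → ℝ) →L[ℝ] (Fin s → ℝ) := LinearMap.toContinuousLinearMap (Matrix.mulVecLin F)
  have hL : ∀ y, L y = F *ᵥ y := fun y => rfl
  let u : ℝ → Fin s → ℝ := fun t => Real.exp (c * t) • L (x t)
  let u' : ℝ → Fin s → ℝ := fun t =>
    Real.exp (c * t) • L (A *ᵥ x t) + (Real.exp (c * t) * c) • L (x t)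
  have hu : ∀ t, 0 ≤ t → HasDerivWithinAt u (u' t) (Set.Ici 0) t := by
    intro t ht
    have h1 : HasDerivWithinAt (fun t => L (x t)) (L (A *ᵥ x t)) (Set.Ici 0) t :=
      L.hasFDerivAt.comp_hasDerivWithinAt t (hx t ht)
    have h2 : HasDerivWithinAt (fun t : ℝ => Real.exp (c * t)) (Real.exp (c * t) * c)
        (Set.Ici 0) t := by
      simpa using (((hasDerivAt_id t).const_mul c).exp).hasDerivWithinAt
    exact h2.smul h1
  have hnorm : ∀ t, ‖u t‖ = Real.exp (c * t) * ‖F *ᵥ x t‖ := fun t => by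
    simp only [u, norm_smul, hL, Real.norm_eq_abs, Real.abs_exp]
  -- Since `‖u'‖ ≤ c ‖u‖`, Grönwall gives `‖u t‖ ≤ ‖u 0‖ exp (c t)`, and the weight built into `u`
  -- cancels the exponential.
  have key := norm_le_gronwallBound_of_norm_deriv_right_le (f := u) (f' := u') (δ := ‖u 0‖)
    (K := c) (ε := 0) (a := 0) (b := t)
    (fun r hr => ((hu r hr.1).continuousWithinAt).mono fun y hy => hy.1)
    (fun r hr => (hu r hr.1).mono (Set.Ici_subset_Ici.2 hr.1)) le_rfl
    (fun r _ => by
      have : u' r = Real.exp (c * r) • (F *ᵥ (A *ᵥ x r) + c • (F *ᵥ x r)) := by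
        simp only [u', hL, smul_add, smul_smul]
      rw [this, norm_smul, Real.norm_eq_abs, Real.abs_exp, hnorm]
      have := mul_le_mul_of_nonneg_left (h (x r)) (Real.exp_pos (c * r)).le
      linarith) t ⟨ht, le_rfl⟩
  rw [gronwallBound_ε0, hnorm, hnorm, sub_zero, mul_zero, Real.exp_zero, one_mul, mul_comm] at key
  exact (le_of_mul_le_mul_right key (Real.exp_pos _)).trans h0

/-! ### Nilpotent endomorphisms in a scaled triangular basis. -/

/-- A nilpotent endomorphism has a basis in which its matrix has arbitrarily small rows. -/
theorem exists_basis_sum_norm_le_of_isNilpotent {K : Type*} [RCLike K] {ε : ℝ} (hε : 0 < ε)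
    (m : ℕ) : ∀ {W : Type*} [AddCommGroup W] [Module K W] [FiniteDimensional K W]
      (N : Module.End K W), IsNilpotent N → Module.finrank K W = m →
      ∃ b : Module.Basis (Fin m) K W, ∀ i, ∃ e : Fin m → K,
        N (b i) = ∑ j, e j • b j ∧ ∑ j, ‖e j‖ ≤ ε := by
  induction m with
  | zero =>
    intro W _ _ _ N _ hm
    exact ⟨Module.finBasisOfFinrankEq K W hm, fun i => i.elim0⟩
  | succ m ih =>
    intro W _ _ _ N hN hm
    -- A nilpotent map on a nonzero space is not onto, so its range lies in a hyperplane `ker f`.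
    -- This hyperplane is invariant, and a vector outside it completes an inductively chosen basis.
    have hlt : LinearMap.range N < ⊤ := by
      rw [lt_top_iff_ne_top]
      intro htop
      obtain ⟨k, hk⟩ := hN
      have hs : Function.Surjective (N ^ k) := by
        rw [Module.End.coe_pow]
        exact (LinearMap.range_eq_top.1 htop).iterate k
      rw [hk] at hs
      have : Subsingleton W := ⟨fun a b => by
        obtain ⟨a, rfl⟩ := hs a
        obtain ⟨b, rfl⟩ := hs b
        simp⟩
      rw [Module.finrank_zero_of_subsingleton] at hm
      omega
    obtain ⟨f, hf0, hf⟩ := Submodule.exists_le_ker_of_lt_top _ hlt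
    have hker : ∀ x, N x ∈ LinearMap.ker f := fun x => hf (LinearMap.mem_range_self N x)
    have hdim : Module.finrank K (LinearMap.ker f) = m := by
      have := Module.Dual.finrank_ker_add_one_of_ne_zero hf0
      omega
    have hres : IsNilpotent (N.restrict (p := LinearMap.ker f) (q := LinearMap.ker f)
        (fun x _ => hker x)) := by
      obtain ⟨k, hk⟩ := hN
      refine ⟨k, ?_⟩
      rw [Module.End.pow_restrict]
      ext x
      simp [hk]
    obtain ⟨b, hb⟩ := ih _ hres hdim
    obtain ⟨y, hy⟩ : ∃ y, f y ≠ 0 := by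
      by_contra! hcon
      exact hf0 (LinearMap.ext hcon)
    let e := b.repr ⟨N y, hker y⟩
    have he : N y = ∑ j, e j • (b j : W) := by
      have := congrArg (LinearMap.ker f).subtype (b.sum_repr ⟨N y, hker y⟩)
      rw [map_sum] at this
      exact this.symm
    let S := ∑ j, ‖e j‖
    have hS : 0 ≤ S := Finset.sum_nonneg fun _ _ => norm_nonneg _
    -- Scaling the new vector scales its image, whose coordinates lie on the old basis only; the `+
    -- 1` covers `S = 0`.
    let t : ℝ := ε / (S + 1)
    have ht : 0 < t := by positivity
    have htK : (t : K) ≠ 0 := by exact_mod_cast ht.ne'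
    have hty : f ((t : K) • y) ≠ 0 := by simp [htK, hy]
    refine ⟨Module.Basis.mkFinCons ((t : K) • y) b ?_ ?_, ?_⟩
    · intro c x hx hc
      have := congrArg f hc
      rw [map_add, map_smul, LinearMap.mem_ker.1 hx, add_zero, map_zero, smul_eq_mul] at this
      exact (mul_eq_zero.1 this).resolve_right hty
    · intro z
      refine ⟨-(f z / f ((t : K) • y)), ?_⟩
      rw [LinearMap.mem_ker, map_add, map_smul, smul_eq_mul, neg_mul, div_mul_cancel₀ _ hty,
        add_neg_cancel]
    · intro i
      rw [Module.Basis.coe_mkFinCons]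
      refine Fin.cases ?_ (fun i => ?_) i
      · refine ⟨Fin.cons 0 fun j => (t : K) * e j, ?_, ?_⟩
        · simp [Fin.sum_univ_succ, he, Finset.smul_sum, smul_smul]
        · simp only [Fin.sum_univ_succ, Fin.cons_zero, Fin.cons_succ, norm_zero, zero_add,
            norm_mul, ← Finset.mul_sum]
          rw [RCLike.norm_ofReal, abs_of_pos ht]
          change ε / (S + 1) * S ≤ ε
          rw [div_mul_eq_mul_div, div_le_iff₀ (by positivity)]
          nlinarith
      · obtain ⟨g, hg, hg'⟩ := hb i
        refine ⟨Fin.cons 0 g, ?_, ?_⟩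
        · have := congrArg Subtype.val hg
          simpa [Fin.sum_univ_succ] using this
        · simpa [Fin.sum_univ_succ] using hg'

/-! ### Rank under field homomorphisms. -/

/-- The invertible matrices that bring `M` to rank normal form stay invertible under `f`, and the
normal form has entries 0 and 1, which `f` fixes. -/
theorem Matrix.rank_map_ringHom {K L : Type*} [Field K] [Field L] {n : Type*} [Fintype n]
    [DecidableEq n] (M : Matrix n n K) (f : K →+* L) : (M.map f).rank = M.rank := by
  obtain ⟨V, U, e, hV, hU, h⟩ := M.exists_rank_normal_form
  have h' : V.map f * M.map f * U.map f = (fromBlocks 1 0 0 0).submatrix e e := by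
    rw [← Matrix.map_mul, ← Matrix.map_mul, h, ← submatrix_map, fromBlocks_map]
    simp
  have hV' : IsUnit (V.map f).det := by
    rw [← RingHom.mapMatrix_apply, ← RingHom.map_det]
    exact ((isUnit_iff_isUnit_det _).1 hV).map f
  have hU' : IsUnit (U.map f).det := by
    rw [← RingHom.mapMatrix_apply, ← RingHom.map_det]
    exact ((isUnit_iff_isUnit_det _).1 hU).map f
  classical
  rw [← rank_mul_eq_right_of_isUnit_det _ (M.map f) hV',
    ← rank_mul_eq_left_of_isUnit_det _ _ hU', h', rank_submatrix, ← diagonal_one,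
    ← diagonal_zero, fromBlocks_diagonal, rank_diagonal]
  simp [Fintype.card_subtype, Fintype.sum_sum_type, Finset.card_filter]

theorem Matrix.rank_add_finrank_ker {K : Type*} [Field K] {n : ℕ} (M : Matrix (Fin n) (Fin n) K) :
    M.rank + Module.finrank K (LinearMap.ker (toLin' M)) = n :=
  (LinearMap.finrank_range_add_finrank_ker (toLin' M)).trans (Module.finrank_fin_fun K)

/-! ### Almost eigenvectors for one eigenvalue. -/

/-- The first `m` members of `v` are linearly independent generalized left eigenvectors of `M`
for `μ`, and are left eigenvectors up to a combination of them with coefficients of sum at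
most `ε`. -/
structure IsAlmostEigenfamily {K : Type*} [RCLike K] {n : ℕ} (M : Matrix (Fin n) (Fin n) K)
    (μ : K) (ε : ℝ) (m : ℕ) (v : ℕ → Fin n → K) : Prop where
  linearIndependent : LinearIndependent K fun i : Fin m => v i
  exists_pow_mulVec_eq_zero : ∀ i < m, ∃ k, ((Mᵀ - μ • (1 : Matrix _ _ K)) ^ k) *ᵥ v i = 0
  exists_vecMul_eq : ∀ i < m, ∃ e : Fin m → K,
    v i ᵥ* M = μ • v i + ∑ j, e j • v j ∧ ∑ j, ‖e j‖ ≤ ε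

namespace IsAlmostEigenfamily

variable {K : Type*} [RCLike K] {n : ℕ} {M : Matrix (Fin n) (Fin n) K} {μ : K}

theorem zero (M : Matrix (Fin n) (Fin n) K) (μ : K) (ε : ℝ) :
    IsAlmostEigenfamily M μ ε 0 0 :=
  ⟨linearIndependent_empty_type, by simp, by simp⟩

/-- Serves both for the inclusion of ℝ in ℂ and for complex conjugation. -/
theorem map {L : Type*} [RCLike L] {ε : ℝ} {m : ℕ} {v : ℕ → Fin n → K}
    (h : IsAlmostEigenfamily M μ ε m v) (f : K →+* L) (hf : ∀ x, ‖f x‖ = ‖x‖) :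
    IsAlmostEigenfamily (M.map f) (f μ) ε m fun i => f ∘ v i where
  linearIndependent := by
    let := f.toAlgebra
    exact linearIndependent_algebraMap_comp_iff.2 h.linearIndependent
  exists_pow_mulVec_eq_zero i hi := by
    obtain ⟨k, hk⟩ := h.exists_pow_mulVec_eq_zero i hi
    refine ⟨k, ?_⟩
    have : ((M.map f)ᵀ - f μ • (1 : Matrix _ _ L)) ^ k =
        f.mapMatrix ((Mᵀ - μ • (1 : Matrix _ _ K)) ^ k) := by
      rw [map_pow, map_sub]
      congr 2
      ext a b
      simp [one_apply, apply_ite f]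
    rw [this]
    ext a
    have := congrArg f (congrFun hk a)
    rw [RingHom.map_mulVec] at this
    simpa using this
  exists_vecMul_eq i hi := by
    obtain ⟨e, he, he'⟩ := h.exists_vecMul_eq i hi
    refine ⟨fun j => f (e j), ?_, by simpa only [hf] using he'⟩
    ext a
    have := congrArg f (congrFun he a)
    rw [RingHom.map_vecMul] at this
    simpa using this

theorem toLin'_transpose_sub_smul_one (M : Matrix (Fin n) (Fin n) K) (μ : K) :
    toLin' Mᵀ - μ • (1 : Module.End K (Fin n → K)) =
      toLin' (Mᵀ - μ • (1 : Matrix _ _ K)) := by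
  rw [map_sub, map_smul, toLin'_one]
  rfl

theorem mem_maxGenEigenspace {ε : ℝ} {m : ℕ} {v : ℕ → Fin n → K}
    (h : IsAlmostEigenfamily M μ ε m v) {i : ℕ} (hi : i < m) :
    v i ∈ Module.End.maxGenEigenspace (toLin' Mᵀ) μ := by
  obtain ⟨k, hk⟩ := h.exists_pow_mulVec_eq_zero i hi
  refine (Module.End.mem_maxGenEigenspace _ _ _).2 ⟨k, ?_⟩
  rwa [toLin'_transpose_sub_smul_one, ← toLin'_pow, toLin'_apply]

/-- A generalized eigenspace has a basis of almost eigenvectors. -/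
theorem exists_of_rootMultiplicity (M : Matrix (Fin n) (Fin n) K) (μ : K) {ε : ℝ} (hε : 0 < ε) :
    ∃ v, IsAlmostEigenfamily M μ ε (M.charpoly.rootMultiplicity μ) v := by
  have hdim : Module.finrank K (Module.End.maxGenEigenspace (toLin' Mᵀ) μ) =
      M.charpoly.rootMultiplicity μ := by
    rw [LinearMap.finrank_maxGenEigenspace_eq, charpoly_toLin', charpoly_transpose]
  generalize M.charpoly.rootMultiplicity μ = m at hdim ⊢
  obtain ⟨b, hb⟩ := exists_basis_sum_norm_le_of_isNilpotent hε m _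
    (Module.End.isNilpotent_restrict_maxGenEigenspace_sub_algebraMap (toLin' Mᵀ) μ) hdim
  refine ⟨fun i => if hi : i < m then b ⟨i, hi⟩ else 0, ?_, ?_, ?_⟩
  · have := b.linearIndependent.map' (Submodule.subtype _) (Submodule.ker_subtype _)
    simp only [Fin.is_lt, dif_pos]
    exact this
  · intro i hi
    obtain ⟨k, hk⟩ := (Module.End.mem_maxGenEigenspace _ _ _).1 (b ⟨i, hi⟩).2
    rw [toLin'_transpose_sub_smul_one, ← toLin'_pow, toLin'_apply] at hk
    exact ⟨k, by simpa [hi] using hk⟩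
  · intro i hi
    obtain ⟨e, he, he'⟩ := hb ⟨i, hi⟩
    refine ⟨e, ?_, he'⟩
    have h : Mᵀ *ᵥ (b ⟨i, hi⟩ : Fin n → K) - μ • (b ⟨i, hi⟩ : Fin n → K) =
        ∑ j, e j • (b j : Fin n → K) := by
      have := congrArg (Submodule.subtype _) he
      rw [map_sum] at this
      exact this
    rw [mulVec_transpose, sub_eq_iff_eq_add'] at h
    simpa only [hi, dif_pos, Fin.is_lt] using h

/-- The left eigenspace has a basis of eigenvectors. -/
theorem exists_of_finrank_ker (M : Matrix (Fin n) (Fin n) K) (μ : K) :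
    ∃ v, IsAlmostEigenfamily M μ 0
      (Module.finrank K (LinearMap.ker (toLin' (M - μ • (1 : Matrix _ _ K))))) v := by
  -- Left and right eigenspaces have equal dimension because a matrix and its transpose have equal
  -- rank.
  have hdim : Module.finrank K (LinearMap.ker (toLin' (Mᵀ - μ • (1 : Matrix _ _ K)))) =
      Module.finrank K (LinearMap.ker (toLin' (M - μ • (1 : Matrix _ _ K)))) := by
    have h1 := rank_add_finrank_ker (M - μ • (1 : Matrix _ _ K))
    have h2 := rank_add_finrank_ker (Mᵀ - μ • (1 : Matrix _ _ K))
    rw [← rank_transpose, transpose_sub, transpose_smul, transpose_one] at h1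
    omega
  generalize Module.finrank K (LinearMap.ker (toLin' (M - μ • (1 : Matrix _ _ K)))) = m at hdim ⊢
  let b := Module.finBasisOfFinrankEq K _ hdim
  have hb : ∀ i, (Mᵀ - μ • (1 : Matrix _ _ K)) *ᵥ (b i : Fin n → K) = 0 := fun i => (b i).2
  refine ⟨fun i => if hi : i < m then b ⟨i, hi⟩ else 0, ?_, ?_, ?_⟩
  · have := b.linearIndependent.map' (Submodule.subtype _) (Submodule.ker_subtype _)
    simp only [Fin.is_lt, dif_pos]
    exact this
  · intro i hi
    exact ⟨1, by simpa [hi] using hb ⟨i, hi⟩⟩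
  · intro i hi
    refine ⟨0, ?_, by simp⟩
    have := hb ⟨i, hi⟩
    rw [sub_mulVec, mulVec_transpose, smul_mulVec, one_mulVec, sub_eq_zero] at this
    simpa [hi] using this

end IsAlmostEigenfamily

/-! ### Compatibility with complex conjugation. -/

theorem complexify_conj {n : ℕ} (A : Matrix (Fin n) (Fin n) ℝ) :
    (complexify A).map (starRingEnd ℂ) = complexify A := by
  ext a b
  simp [complexify]

theorem Matrix.finrank_ker_map_ringHom {K L : Type*} [Field K] [Field L] {n : ℕ}
    (M : Matrix (Fin n) (Fin n) K) (f : K →+* L) (μ : K) :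
    Module.finrank L (LinearMap.ker (toLin' (M.map f - f μ • (1 : Matrix _ _ L)))) =
      Module.finrank K (LinearMap.ker (toLin' (M - μ • (1 : Matrix _ _ K)))) := by
  have h1 := rank_add_finrank_ker (M - μ • (1 : Matrix _ _ K))
  have h2 := rank_add_finrank_ker (M.map f - f μ • (1 : Matrix _ _ L))
  have h3 : M.map f - f μ • (1 : Matrix _ _ L) = (M - μ • (1 : Matrix _ _ K)).map f := by
    ext a b
    simp [one_apply, apply_ite f]
  rw [h3, rank_map_ringHom, ← h3] at h2
  omega

theorem algm_conj {n : ℕ} (A : Matrix (Fin n) (Fin n) ℝ) (l : ℂ) :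
    algm A (starRingEnd ℂ l) = algm A l := by
  rw [algm, algm, Polynomial.eq_rootMultiplicity_map (starRingEnd ℂ).injective l,
    ← charpoly_map, complexify_conj]

theorem geom_conj {n : ℕ} (A : Matrix (Fin n) (Fin n) ℝ) (l : ℂ) :
    geom A (starRingEnd ℂ l) = geom A l := by
  rw [geom, geom, ← finrank_ker_map_ringHom _ (starRingEnd ℂ) l, complexify_conj]

theorem num_conj {n : ℕ} (A : Matrix (Fin n) (Fin n) ℝ) (l : ℂ) :
    num A (starRingEnd ℂ l) = num A l := by
  simp [num, algm_conj, geom_conj]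

/-- Almost eigenvectors for a real eigenvalue may be chosen real. -/
theorem exists_real_almostEigenfamily {n : ℕ} (A : Matrix (Fin n) (Fin n) ℝ) (a : ℝ) :
    ∃ v : ℕ → Fin n → ℝ, IsAlmostEigenfamily A a (-a / 2) (num A a) v := by
  rcases lt_trichotomy a 0 with ha | rfl | ha
  · have : num A a = A.charpoly.rootMultiplicity a := by
      rw [num, if_pos (by simpa using ha), algm, complexify, charpoly_map,
        ← Complex.coe_algebraMap, ← Polynomial.eq_rootMultiplicity_map (algebraMap ℝ ℂ).injective]
    rw [this]
    exact IsAlmostEigenfamily.exists_of_rootMultiplicity A a (by linarith)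
  · have : num A (0 : ℝ) =
        Module.finrank ℝ (LinearMap.ker (toLin' (A - (0 : ℝ) • (1 : Matrix _ _ ℝ)))) := by
      rw [num, if_neg (by simp), if_pos (by simp), geom, complexify,
        ← Complex.coe_algebraMap, finrank_ker_map_ringHom]
    rw [this, neg_zero, zero_div]
    exact IsAlmostEigenfamily.exists_of_finrank_ker A 0
  · have : num A a = 0 := by
      rw [num, if_neg (by simp [ha.le]), if_neg (by simp [ha.ne']), if_neg (by simp),
        if_neg (by simp)]
    rw [this]
    -- The allowed error `-a / 2` is negative here, which the empty family satisfies vacuously.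
    exact ⟨0, .zero ..⟩

/-- The sign of `l.re + |l.im|` decides between scaled generalized eigenvectors, exact eigenvectors
and the empty family. Reality at real `l` makes the later definition by conjugation consistent on
the real axis. -/
theorem exists_almostEigenfamily {n : ℕ} (A : Matrix (Fin n) (Fin n) ℝ) (l : ℂ) :
    ∃ v : ℕ → Fin n → ℂ,
      IsAlmostEigenfamily (complexify A) l (-(l.re + |l.im|) / 2) (num A l) v ∧
      (l.im = 0 → ∀ i k, starRingEnd ℂ (v i k) = v i k) := by
  by_cases hl : l.im = 0
  · obtain ⟨a, rfl⟩ : ∃ a : ℝ, l = a := ⟨l.re, Complex.ext rfl (by simp [hl])⟩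
    obtain ⟨v, hv⟩ := exists_real_almostEigenfamily A a
    refine ⟨fun i => algebraMap ℝ ℂ ∘ v i, ?_, ?_⟩
    · simpa [complexify] using hv.map (algebraMap ℝ ℂ) (fun x => by simp)
    · intro _ i k
      simp
  · simp only [hl, false_imp_iff, and_true]
    rcases lt_trichotomy (l.re + |l.im|) 0 with h | h | h
    · have : num A l = algm A l := by
        rw [num, if_neg (by simp [hl]), if_neg (by simp [hl]), if_pos ⟨hl, h⟩]
      rw [this]
      exact IsAlmostEigenfamily.exists_of_rootMultiplicity _ l (by linarith)
    · have : num A l = geom A l := by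
        rw [num, if_neg (by simp [hl]), if_neg (by simp [hl]), if_neg (by simp [h]),
          if_pos ⟨hl, h⟩]
      rw [this, h, neg_zero, zero_div]
      exact IsAlmostEigenfamily.exists_of_finrank_ker _ l
    · have : num A l = 0 := by
        rw [num, if_neg (by simp [hl]), if_neg (by simp [hl]), if_neg (by simp [h.le]),
          if_neg (by simp [h.ne'])]
      rw [this]
      exact ⟨0, .zero ..⟩

/-- Almost eigenvectors may be chosen compatibly with complex conjugation. -/
theorem exists_conj_almostEigenfamilies {n : ℕ} (A : Matrix (Fin n) (Fin n) ℝ) :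
    ∃ v : ℂ → ℕ → Fin n → ℂ,
      (∀ l, IsAlmostEigenfamily (complexify A) l (-(l.re + |l.im|) / 2) (num A l) (v l)) ∧
      ∀ l i k, v (starRingEnd ℂ l) i k = starRingEnd ℂ (v l i k) := by
  choose V hV hreal using exists_almostEigenfamily A
  -- Choose freely on the closed upper half plane and conjugate below it. Indexing by ℕ avoids
  -- transport along `num A (starRingEnd ℂ l) = num A l`.
  refine ⟨fun l => if 0 ≤ l.im then V l else fun i => starRingEnd ℂ ∘ V (starRingEnd ℂ l) i,
    fun l => ?_, fun l i k => ?_⟩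
  · by_cases hl : 0 ≤ l.im
    · simpa only [hl, if_true] using hV l
    · simp only [hl, if_false]
      have := (hV (starRingEnd ℂ l)).map (starRingEnd ℂ) (fun x => by simp)
      simpa only [complexify_conj, Complex.conj_conj, num_conj, Complex.conj_re, Complex.conj_im,
        abs_neg] using this
  · rcases lt_trichotomy l.im 0 with hl | hl | hl
    · simp [hl.not_ge, hl.le]
    · have : starRingEnd ℂ l = l := Complex.conj_eq_iff_im.2 hl
      simp [this, hl, hreal l hl]
    · simp [hl.not_ge, hl.le]

/-! ### Collecting the eigenvalues. -/

theorem iSupIndep.linearIndependent_sigma {K V : Type*} [DivisionRing K] [AddCommGroup V]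
    [Module K V] {η : Type*} {ι : η → Type*} {p : η → Submodule K V} (hp : iSupIndep p)
    {v : ∀ i, ι i → V} (hv : ∀ i, LinearIndependent K (v i)) (hmem : ∀ i j, v i j ∈ p i) :
    LinearIndependent K fun x : Σ i, ι i => v x.1 x.2 := by
  have hspan : ∀ i, Submodule.span K (Set.range (v i)) ≤ p i := fun i =>
    Submodule.span_le.2 (Set.range_subset_iff.2 (hmem i))
  refine linearIndependent_iUnion_finite hv fun i t _ hi => (hp i).mono (hspan i) ?_
  refine iSup₂_le fun j hj => (hspan j).trans ?_
  exact le_iSup₂_of_le j (by rintro rfl; exact hi hj) le_rfl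

theorem conj_mem_eigenvalueSet {n : ℕ} {A : Matrix (Fin n) (Fin n) ℝ} {l : ℂ}
    (hl : l ∈ eigenvalueSet A) : starRingEnd ℂ l ∈ eigenvalueSet A := by
  rw [eigenvalueSet, Multiset.mem_toFinset, ← Multiset.count_pos, Polynomial.count_roots] at hl ⊢
  change 0 < algm A _
  rwa [algm_conj]

/-! ### Real rows from conjugate pairs of complex vectors. -/

section Rows

variable {n : ℕ} {A : Matrix (Fin n) (Fin n) ℝ} {v : ℂ → ℕ → Fin n → ℂ}

/-- The real part of `v l i` if `l` is in the closed upper half plane, else the imaginary part. -/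
noncomputable def realRow (v : ℂ → ℕ → Fin n → ℂ) (l : ℂ) (i : ℕ) (k : Fin n) : ℝ :=
  if 0 ≤ l.im then (v l i k).re else (v l i k).im

theorem eq_realRow_of_im_eq_zero
    (hconj : ∀ l i k, v (starRingEnd ℂ l) i k = starRingEnd ℂ (v l i k))
    {l : ℂ} (hl : l.im = 0) (i : ℕ) (k : Fin n) : v l i k = realRow v l i k := by
  have := hconj l i k
  rw [Complex.conj_eq_iff_im.2 hl, eq_comm, Complex.conj_eq_iff_im] at this
  apply Complex.ext <;> simp [realRow, hl, this]

theorem eq_realRow_of_im_pos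
    (hconj : ∀ l i k, v (starRingEnd ℂ l) i k = starRingEnd ℂ (v l i k))
    {l : ℂ} (hl : 0 < l.im) (i : ℕ) (k : Fin n) :
    v l i k = realRow v l i k - Complex.I * realRow v (starRingEnd ℂ l) i k := by
  apply Complex.ext <;> simp [realRow, hl.le, hl.not_ge, hconj]

theorem eq_realRow_of_im_neg
    (hconj : ∀ l i k, v (starRingEnd ℂ l) i k = starRingEnd ℂ (v l i k))
    {l : ℂ} (hl : l.im < 0) (i : ℕ) (k : Fin n) :
    v l i k = realRow v (starRingEnd ℂ l) i k + Complex.I * realRow v l i k := by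
  apply Complex.ext <;> simp [realRow, hl.le, hl.not_ge, hconj]

/-- Dimension count: the complex span of the real rows contains all the vectors `v l i`, and there
are equally many of both. -/
theorem linearIndependent_realRow
    (hconj : ∀ l i k, v (starRingEnd ℂ l) i k = starRingEnd ℂ (v l i k))
    (hv : LinearIndependent ℂ
      fun x : Σ l : eigenvalueSet A, Fin (num A l) => v x.1 x.2) :
    LinearIndependent ℝ fun x : Σ l : eigenvalueSet A, Fin (num A l) => realRow v x.1 x.2 := by
  rw [← linearIndependent_algebraMap_comp_iff (S := ℂ), linearIndependent_iff_card_le_finrank_span,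
    linearIndependent_iff_card_eq_finrank_span.1 hv]
  refine Submodule.finrank_mono (Submodule.span_le.2 ?_)
  have hmem : ∀ l ∈ eigenvalueSet A, ∀ i < num A l, (algebraMap ℝ ℂ ∘ realRow v l i) ∈
      Submodule.span ℂ (Set.range fun x : Σ l : eigenvalueSet A, Fin (num A l) =>
        algebraMap ℝ ℂ ∘ realRow v x.1 x.2) := fun l hl i hi =>
    Submodule.subset_span ⟨⟨⟨l, hl⟩, ⟨i, hi⟩⟩, rfl⟩
  rintro _ ⟨⟨⟨l, hl⟩, ⟨i, hi⟩⟩, rfl⟩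
  have h1 := hmem l hl i hi
  have h2 := hmem _ (conj_mem_eigenvalueSet hl) i (by rwa [num_conj])
  change v l i ∈ Submodule.span ℂ _
  rcases lt_trichotomy l.im 0 with h | h | h
  · have : v l i = algebraMap ℝ ℂ ∘ realRow v (starRingEnd ℂ l) i +
        Complex.I • (algebraMap ℝ ℂ ∘ realRow v l i) := by
      ext k
      simpa using eq_realRow_of_im_neg hconj h i k
    exact this ▸ Submodule.add_mem _ h2 (Submodule.smul_mem _ Complex.I h1)
  · have : v l i = algebraMap ℝ ℂ ∘ realRow v l i := by
      ext k
      simpa using eq_realRow_of_im_eq_zero hconj h i k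
    exact this ▸ h1
  · have : v l i = algebraMap ℝ ℂ ∘ realRow v l i -
        Complex.I • (algebraMap ℝ ℂ ∘ realRow v (starRingEnd ℂ l) i) := by
      ext k
      simpa using eq_realRow_of_im_pos hconj h i k
    exact this ▸ Submodule.sub_mem _ h1 (Submodule.smul_mem _ Complex.I h2)

/-- Up to sign and order, the rows of `l` and its conjugate are the real and imaginary parts of `v l
i`; for real `l` the imaginary part vanishes. -/
theorem abs_re_le_and_abs_im_le
    (hconj : ∀ l i k, v (starRingEnd ℂ l) i k = starRingEnd ℂ (v l i k)) {x : Fin n → ℝ} {R : ℝ}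
    {l : ℂ} {i : ℕ} (h1 : |realRow v l i ⬝ᵥ x| ≤ R)
    (h2 : |realRow v (starRingEnd ℂ l) i ⬝ᵥ x| ≤ R) :
    |(v l i ⬝ᵥ (algebraMap ℝ ℂ ∘ x)).re| ≤ R ∧ |(v l i ⬝ᵥ (algebraMap ℝ ℂ ∘ x)).im| ≤ R := by
  have hR : 0 ≤ R := (abs_nonneg _).trans h1
  rcases lt_trichotomy l.im 0 with h | h | h
  · have : v l i ⬝ᵥ (algebraMap ℝ ℂ ∘ x) = (realRow v (starRingEnd ℂ l) i ⬝ᵥ x : ℝ) +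
        Complex.I * (realRow v l i ⬝ᵥ x : ℝ) := by
      simp [dotProduct, eq_realRow_of_im_neg hconj h, add_mul, Finset.sum_add_distrib,
        Finset.mul_sum, mul_assoc]
    rw [this]
    simpa using ⟨h2, h1⟩
  · have : v l i ⬝ᵥ (algebraMap ℝ ℂ ∘ x) = (realRow v l i ⬝ᵥ x : ℝ) := by
      simp [dotProduct, eq_realRow_of_im_eq_zero hconj h]
    rw [this]
    simpa using ⟨h1, hR⟩
  · have : v l i ⬝ᵥ (algebraMap ℝ ℂ ∘ x) = (realRow v l i ⬝ᵥ x : ℝ) -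
        Complex.I * (realRow v (starRingEnd ℂ l) i ⬝ᵥ x : ℝ) := by
      simp [dotProduct, eq_realRow_of_im_pos hconj h, sub_mul, Finset.sum_sub_distrib,
        Finset.mul_sum, mul_assoc]
    rw [this]
    simpa using ⟨h1, h2⟩

theorem realRow_dotProduct (l : ℂ) (i : ℕ) (x : Fin n → ℝ) :
    realRow v l i ⬝ᵥ x = if 0 ≤ l.im then (v l i ⬝ᵥ (algebraMap ℝ ℂ ∘ x)).re
      else (v l i ⬝ᵥ (algebraMap ℝ ℂ ∘ x)).im := by
  split_ifs with h <;> simp [dotProduct, realRow, h]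

/-- Replacing `x` by `A *ᵥ x` turns `z = v l i ⬝ᵥ x` into `l z + w`, with `w` the almost-eigenvector
error. After subtracting `l.re * z`, each of the real and imaginary parts is at most `|l.im| R +
‖w‖`, and `‖w‖ ≤ -(l.re + |l.im|) R` makes this `-l.re * R`. -/
theorem abs_realRow_dotProduct_mulVec_sub_le
    (hconj : ∀ l i k, v (starRingEnd ℂ l) i k = starRingEnd ℂ (v l i k)) {l : ℂ}
    (hv : IsAlmostEigenfamily (complexify A) l (-(l.re + |l.im|) / 2) (num A l) (v l))
    {x : Fin n → ℝ} {R : ℝ} (h1 : ∀ j < num A l, |realRow v l j ⬝ᵥ x| ≤ R)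
    (h2 : ∀ j < num A l, |realRow v (starRingEnd ℂ l) j ⬝ᵥ x| ≤ R) {i : ℕ} (hi : i < num A l) :
    |realRow v l i ⬝ᵥ (A *ᵥ x) - l.re * (realRow v l i ⬝ᵥ x)| ≤ -l.re * R := by
  have hR : 0 ≤ R := (abs_nonneg _).trans (h1 i hi)
  obtain ⟨e, he, he'⟩ := hv.exists_vecMul_eq i hi
  have hz := fun j hj => abs_re_le_and_abs_im_le hconj (h1 j hj) (h2 j hj)
  let z : ℕ → ℂ := fun j => v l j ⬝ᵥ (algebraMap ℝ ℂ ∘ x)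
  let w : ℂ := ∑ j, e j * z j
  have hA : v l i ⬝ᵥ (algebraMap ℝ ℂ ∘ (A *ᵥ x)) = l * z i + w := by
    have : (algebraMap ℝ ℂ ∘ (A *ᵥ x)) = complexify A *ᵥ (algebraMap ℝ ℂ ∘ x) := by
      ext k
      exact RingHom.map_mulVec _ _ _ _
    rw [this, dotProduct_mulVec, he, add_dotProduct, smul_dotProduct, sum_dotProduct]
    simp only [smul_dotProduct, smul_eq_mul, w, z]
  have hw : ‖w‖ ≤ -(l.re + |l.im|) * R := by
    -- The 2 comes from `‖z‖ ≤ |re z| + |im z|` and cancels the halving in the error bound of the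
    -- family.
    calc ‖w‖ ≤ ∑ j, ‖e j‖ * (2 * R) := by
          refine (norm_sum_le _ _).trans (Finset.sum_le_sum fun j _ => ?_)
          rw [norm_mul]
          refine mul_le_mul_of_nonneg_left ?_ (norm_nonneg _)
          have := Complex.norm_le_abs_re_add_abs_im (z j)
          have := hz j j.2
          linarith [this.1, this.2]
      _ ≤ -(l.re + |l.im|) * R := by
          rw [← Finset.sum_mul]
          nlinarith
  have hre : |w.re| ≤ ‖w‖ := Complex.abs_re_le_norm w
  have him : |w.im| ≤ ‖w‖ := Complex.abs_im_le_norm w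
  obtain ⟨hzre, hzim⟩ := hz i hi
  rw [realRow_dotProduct, realRow_dotProduct, hA]
  split_ifs with h
  · calc |(l * z i + w).re - l.re * (z i).re| = |w.re - l.im * (z i).im| := by
          congr 1
          simp
          ring
      _ ≤ |w.re| + |l.im| * |(z i).im| := by
          rw [← abs_mul]
          exact abs_sub _ _
      _ ≤ -l.re * R := by nlinarith [mul_le_mul_of_nonneg_left hzim (abs_nonneg l.im)]
  · calc |(l * z i + w).im - l.re * (z i).im| = |w.im + l.im * (z i).re| := by
          congr 1
          simp
          ring
      _ ≤ |w.im| + |l.im| * |(z i).re| := by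
          rw [← abs_mul]
          exact abs_add_le _ _
      _ ≤ -l.re * R := by nlinarith [mul_le_mul_of_nonneg_left hzre (abs_nonneg l.im)]

end Rows

/-! ### Assembly of the invariant. -/

theorem theorem2 (n : ℕ) (A : Matrix (Fin n) (Fin n) ℝ) (s : ℕ)
    (hs : s = ∑ l ∈ eigenvalueSet A, num A l) :
    ∃ F : Matrix (Fin s) (Fin n) ℝ,
      LinearIndependent ℝ F.row ∧ IsLinearInvariant A F := by
  obtain ⟨v, hv, hconj⟩ := exists_conj_almostEigenfamilies A
  have hcard : Fintype.card (Σ l : eigenvalueSet A, Fin (num A l)) = s := by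
    simp only [hs, Fintype.card_sigma, Fintype.card_fin]
    exact Finset.sum_coe_sort (eigenvalueSet A) (num A)
  let φ := (Fintype.equivFinOfCardEq hcard).symm
  let F : Matrix (Fin s) (Fin n) ℝ := Matrix.of fun j => realRow v (φ j).1 (φ j).2
  have hF : ∀ j y, (F *ᵥ y) j = realRow v (φ j).1 (φ j).2 ⬝ᵥ y := fun _ _ => rfl
  have hind : LinearIndependent ℂ
      fun x : Σ l : eigenvalueSet A, Fin (num A l) => v x.1 x.2 :=
    ((Module.End.independent_maxGenEigenspace (toLin' (complexify A)ᵀ)).comp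
      Subtype.val_injective).linearIndependent_sigma
      (v := fun (l : eigenvalueSet A) (i : Fin (num A l)) => v l i)
      (fun l => (hv l).linearIndependent) (fun l i => (hv l).mem_maxGenEigenspace i.2)
  refine ⟨F, (linearIndependent_realRow hconj hind).comp φ φ.injective, ?_⟩
  -- Any nonnegative `c` with `c + l.re ≥ 0` for all eigenvalues would do; a sum avoids taking a
  -- maximum over a possibly empty set.
  let c : ℝ := ∑ l ∈ eigenvalueSet A, |l.re|
  refine isLinearInvariant_of_norm_le (c := c) fun x => ?_
  have hrow : ∀ l ∈ eigenvalueSet A, ∀ i < num A l, |realRow v l i ⬝ᵥ x| ≤ ‖F *ᵥ x‖ := by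
    intro l hl i hi
    have := norm_le_pi_norm (F *ᵥ x) (φ.symm ⟨⟨l, hl⟩, ⟨i, hi⟩⟩)
    rwa [hF, Equiv.apply_symm_apply] at this
  have hc : 0 ≤ c := Finset.sum_nonneg fun _ _ => abs_nonneg _
  refine (pi_norm_le_iff_of_nonneg (by positivity)).2 fun j => ?_
  rcases hj : φ j with ⟨⟨l, hl⟩, ⟨i, hi⟩⟩
  have key := abs_realRow_dotProduct_mulVec_sub_le hconj (hv l) (hrow l hl)
    (fun j hj => hrow _ (conj_mem_eigenvalueSet hl) j (by rwa [num_conj])) hi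
  have hlc : -l.re ≤ c := (neg_le_abs l.re).trans
    (Finset.single_le_sum (f := fun l : ℂ => |l.re|) (fun _ _ => abs_nonneg _) hl)
  rw [Pi.add_apply, Pi.smul_apply, hF, hF, hj, smul_eq_mul, Real.norm_eq_abs]
  calc |realRow v l i ⬝ᵥ (A *ᵥ x) + c * (realRow v l i ⬝ᵥ x)|
      = |(realRow v l i ⬝ᵥ (A *ᵥ x) - l.re * (realRow v l i ⬝ᵥ x)) +
          (c + l.re) * (realRow v l i ⬝ᵥ x)| := by congr 1; ring
    _ ≤ -l.re * ‖F *ᵥ x‖ + (c + l.re) * ‖F *ᵥ x‖ := by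
        refine (abs_add_le _ _).trans (add_le_add key ?_)
        rw [abs_mul, abs_of_nonneg (by linarith : 0 ≤ c + l.re)]
        exact mul_le_mul_of_nonneg_left (hrow l hl i hi) (by linarith)
    _ = c * ‖F *ᵥ x‖ := by ring
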